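/- Let $\mathcal{M}_f = (\mathcal{S}, \mathcal{A}, p, p_0, f)$ be an average general-utility Markov decision process (GUMDP): $\mathcal{S}$ and $\mathcal{A}$ are finite state and action spaces, $p(\cdot \mid s,a) \in \Delta(\mathcal{S})$ are the transition probabilities, $p_0 \in \Delta(\mathcal{S})$ is the initial state distribution, and $f : \Delta(\mathcal{S} \times \mathcal{A}) \to \mathbb{R}$ is the objective function, where $\Delta(\mathcal X)$ denotes the set of probability vectors on $\mathcal X$. A stationary policy is a map $\pi : \mathcal{S} \to \Delta(\mathcal{A})$; let $\zeta_\pi$ be the law of the trajectory $T = (S_0, A_0, S_1, A_1, \ldots)$ with $S_0 \sim p_0$, $A_t \sim \pi(\cdot \mid S_t)$ and $S_{t+1} \sim p(\cdot \mid S_t, A_t)$. Let $$d_\pi(s,a) = \lim_{H \to \infty} \frac{1}{H} \sum_{t=0}^{H-1} \mathbb{P}_{\zeta_\pi}(S_t = s, A_t = a), \qquad f_\infty(\pi) = f(d_\pi),$$ and, for $K \geq 1$ independent trajectories $T_k = (S_{k,0}, A_{k,0}, S_{k,1}, A_{k,1}, \ldots) \sim \zeta_\pi$, $k = 1, \ldots,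 K$, $$\hat d_K(s,a) = \frac{1}{K} \sum_{k=1}^{K} \lim_{H \to \infty} \frac{1}{H} \sum_{t=0}^{H-1} \mathbf{1}(S_{k,t} = s, A_{k,t} = a), \qquad f_K(\pi) = \mathbb{E}\big[f(\hat d_K)\big].$$ Suppose that $\mathcal{M}_f$ is unichain, i.e. for every deterministic stationary policy $\delta : \mathcal{S} \to \mathcal{A}$ the Markov chain on $\mathcal{S}$ with transition matrix $P^\delta(s,s') = p(s' \mid s, \delta(s))$ has exactly one recurrent class (a communicating class each of whose states is returned to with probability one), all other states being transient. Suppose also that $f$ is bounded and continuous. Then, for every stationary policy $\pi$ (possibly randomized) and every integer $K \geq 1$, the limits defining $d_\pi$ exist and $d_\pi \in \Delta(\mathcal{S} \times \mathcal{A})$, the limits defining $\hat d_K$ exist and $\hat d_K \in \Delta(\mathcal{S} \times \mathcal{A})$ almost surely, $f(\hat d_K)$ is integrable, and $$f_K(\pi) = f_\infty(\pi).$$ -/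

import Mathlib

open MeasureTheory ProbabilityTheory Filter Topology

noncomputable section

namespace MarkovChain

variable {X : Type*} [MeasurableSpace X] [DiscreteMeasurableSpace X]

/-- The transition kernel with `P x` as the law of the next state when the current state is `x`. -/
def kernel (P : X → PMF X) : Kernel X X where
  toFun x := (P x).toMeasure
  measurable' := Measurable.of_discrete

instance (P : X → PMF X) : IsMarkovKernel (kernel P) :=
  ⟨fun x => inferInstanceAs (IsProbabilityMeasure (P x).toMeasure)⟩

/-- The transition kernel as a function of the history `(x_0, …, x_n)`; only `x_n` matters. -/
def historyKernel (P : X → PMF X) (n : ℕ) : Kernel (Finset.Iic n → X) X :=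
  (kernel P).comap (fun x => x ⟨n, Finset.mem_Iic.2 le_rfl⟩) (measurable_pi_apply _)

instance (P : X → PMF X) (n : ℕ) : IsMarkovKernel (historyKernel P n) :=
  inferInstanceAs (IsMarkovKernel ((kernel P).comap _ _))

/-- The law on `X^ℕ` of the time-homogeneous Markov chain with initial distribution `μ₀` and
transition probabilities `P`. -/
def law (μ₀ : PMF X) (P : X → PMF X) : Measure (ℕ → X) :=
  Kernel.trajMeasure (X := fun _ => X) μ₀.toMeasure (historyKernel P)

instance (μ₀ : PMF X) (P : X → PMF X) : IsProbabilityMeasure (law μ₀ P) :=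
  inferInstanceAs (IsProbabilityMeasure
    (Kernel.trajMeasure (X := fun _ => X) μ₀.toMeasure (historyKernel P)))

/-- A state is recurrent if the chain started there returns to it with probability one. -/
def IsRecurrent (P : X → PMF X) (x : X) : Prop :=
  law (PMF.pure x) P {ω | ∃ n, 1 ≤ n ∧ ω n = x} = 1

end MarkovChain

namespace MarkovChain

variable {X : Type*}

/-- `y` is reachable from `x` (in zero or more steps of positive probability). -/
def Reachable (P : X → PMF X) : X → X → Prop :=
  Relation.ReflTransGen fun x y => 0 < P x y

/-- The communicating class of `x`. -/
def commClass (P : X → PMF X) (x : X) : Set X :=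
  {y | Reachable P x y ∧ Reachable P y x}

/-- A recurrent class is a communicating class all of whose states are recurrent. -/
def IsRecurrentClass [MeasurableSpace X] [DiscreteMeasurableSpace X]
    (P : X → PMF X) (C : Set X) : Prop :=
  (∃ x, C = commClass P x) ∧ ∀ y ∈ C, IsRecurrent P y

end MarkovChain

/-- A general-utility Markov decision process `(S, A, p, p₀, f)` with finite `S` and `A`. -/
structure GUMDP (S A : Type*) [Fintype S] [Fintype A] where
  /-- transition probabilities: `p s a s'` is `p(s' | s, a)` -/
  p : S → A → PMF S
  /-- initial state distribution -/
  p₀ : PMF S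
  /-- objective, a function of state-action occupancies -/
  f : stdSimplex ℝ (S × A) → ℝ

namespace GUMDP

variable {S A : Type*} [Fintype S] [Fintype A] (M : GUMDP S A)

/-- The transition matrix `P^π(s, s') = ∑ₐ π(a | s) p(s' | s, a)` of a stationary policy. -/
def stateStep (π : S → PMF A) (s : S) : PMF S := (π s).bind (M.p s)

/-- The law of `(S, A)` when `S ∼ μ` and `A ∼ π(· | S)`. -/
def withAction (π : S → PMF A) (μ : PMF S) : PMF (S × A) :=
  μ.bind fun s => (π s).map (Prod.mk s)

/-- Unichain: under every deterministic stationary policy `δ : S → A` there is exactly one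
recurrent class (all the other states being transient). -/
def IsUnichain [MeasurableSpace S] [DiscreteMeasurableSpace S] : Prop :=
  ∀ δ : S → A, ∃! C : Set S,
    MarkovChain.IsRecurrentClass (M.stateStep fun s => PMF.pure (δ s)) C

/-- The function `f` on vectors; it is `f` on the simplex and has the dummy value `0` elsewhere. -/
def utility (d : S × A → ℝ) : ℝ :=
  open scoped Classical in
  if h : d ∈ stdSimplex ℝ (S × A) then M.f ⟨d, h⟩ else 0

/-- `(1/H) ∑_{t < H} 1(S_t = s, A_t = a)` along the trajectory `T`. -/
def empFreq (T : ℕ → S × A) (x : S × A) (H : ℕ) : ℝ :=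
  open scoped Classical in
  (1 / (H : ℝ)) * ∑ t ∈ Finset.range H, if T t = x then 1 else 0

/-- The empirical average occupancy of one infinite trajectory. -/
def empOccupancy (T : ℕ → S × A) (x : S × A) : ℝ :=
  limUnder atTop (empFreq T x)

/-- The empirical average occupancy of `K` infinite trajectories. -/
def empOccupancyK {K : ℕ} (T : Fin K → ℕ → S × A) (x : S × A) : ℝ :=
  (1 / (K : ℝ)) * ∑ k, empOccupancy (T k) x

variable [MeasurableSpace S] [DiscreteMeasurableSpace S]
  [MeasurableSpace A] [DiscreteMeasurableSpace A]

/-- The law `ζ_π` of the trajectory `(S_0, A_0, S_1, A_1, …)` under the stationary policy `π`: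
`S_0 ∼ p₀`, `A_t ∼ π(· | S_t)`, `S_{t+1} ∼ p(· | S_t, A_t)`. -/
def trajLaw (π : S → PMF A) : Measure (ℕ → S × A) :=
  MarkovChain.law (withAction π M.p₀) fun x => withAction π (M.p x.1 x.2)

instance (π : S → PMF A) : IsProbabilityMeasure (M.trajLaw π) :=
  inferInstanceAs (IsProbabilityMeasure (MarkovChain.law _ _))

/-- The joint law of `K` independent trajectories. -/
def trialsLaw (π : S → PMF A) (K : ℕ) : Measure (Fin K → ℕ → S × A) :=
  Measure.pi fun _ => M.trajLaw π

/-- `(1/H) ∑_{t < H} ℙ(S_t = s, A_t = a)`. -/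
def meanFreq (π : S → PMF A) (x : S × A) (H : ℕ) : ℝ :=
  (1 / (H : ℝ)) * ∑ t ∈ Finset.range H, (M.trajLaw π).real {T | T t = x}

/-- The average state-action occupancy `d_π`. -/
def occupancy (π : S → PMF A) (x : S × A) : ℝ :=
  limUnder atTop (M.meanFreq π x)

/-- The finite trials objective `f_K(π) = 𝔼[f(d̂)]`, with `d̂` the empirical average occupancy of
`K` independent trajectories. -/
def finiteTrials (K : ℕ) (π : S → PMF A) : ℝ :=
  ∫ T, M.utility (empOccupancyK T) ∂(M.trialsLaw π K)

/-- The infinite trials objective `f_∞(π) = f(d_π)`. -/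
def infiniteTrials (π : S → PMF A) : ℝ :=
  M.utility (M.occupancy π)

end GUMDP

end

/-! Along almost every trajectory the visit frequencies converge to one deterministic vector `d`.
Hence the empirical occupancy of `K` trajectories is almost surely `d`, dominated convergence gives
`d_π = d`, and both objectives equal `f d`.

The frequencies obey a strong law because every harmonic function of the state-action chain is
constant (`IsUnichain.eq_of_stepMean_eq`). Given a randomized `π`, pick `δ s` in the support of `π
s`. By the maximum principle the sets where a harmonic function attains its maximum and its minimum
are closed under `δ`. Each contains a recurrent class (`exists_isRecurrentClass`), the two classes
coincide by the unichain property, so maximum equals minimum.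

Constancy makes the Poisson equation `g = c + h - P h` solvable (`exists_poisson`). Sums of `g`
along the path are then `n * c` plus a bounded telescoping term plus a martingale whose second
moment grows linearly, which gives the strong law (`exists_ae_tendsto_visits`). -/

namespace MarkovChain

/-! ### One-step averages and the maximum principle -/

section StepMean

variable {X : Type*} [Fintype X]

/-- The expectation of `h` one step ahead, as a function of the current state. -/
noncomputable def stepMean (P : X → PMF X) (h : X → ℝ) (x : X) : ℝ :=
  ∑ y, (P x y).toReal * h y

lemma sum_toReal_eq_one (p : PMF X) : ∑ y, (p y).toReal = 1 := by
  rw [← ENNReal.toReal_sum fun y _ => p.apply_ne_top y, ← tsum_fintype (L := .unconditional X),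
    p.tsum_coe, ENNReal.toReal_one]

/-- If a weighted average equals an upper bound of the values, every value of positive weight
attains the bound. -/
lemma eq_of_average_eq (p : PMF X) {h : X → ℝ} {m : ℝ} (hle : ∀ y, 0 < p y → h y ≤ m)
    (heq : m ≤ ∑ y, (p y).toReal * h y) {y : X} (hy : 0 < p y) : h y = m := by
  have key : ∀ z, 0 ≤ (p z).toReal * (m - h z) := by
    intro z
    rcases eq_or_ne (p z) 0 with hz | hz
    · simp [hz]
    · exact mul_nonneg ENNReal.toReal_nonneg (sub_nonneg.2 (hle z (pos_iff_ne_zero.2 hz)))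
  have hsum : ∑ z, (p z).toReal * (m - h z) ≤ 0 := by
    simp only [mul_sub, Finset.sum_sub_distrib, ← Finset.sum_mul, sum_toReal_eq_one]
    linarith
  have h0 := (Finset.sum_eq_zero_iff_of_nonneg fun z _ => key z).1
    (le_antisymm hsum (Finset.sum_nonneg fun z _ => key z)) y (Finset.mem_univ y)
  rcases mul_eq_zero.1 h0 with h1 | h1
  · exact absurd h1 (ENNReal.toReal_pos hy.ne' (p.apply_ne_top y)).ne'
  · linarith

end StepMean

/-! ### The Markov property of the trajectory law -/

section MarkovProperty

variable {X : Type*}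

/-- The trajectory that follows a finite history and then stays where the history ends. -/
def extendHistory (n : ℕ) (y : Finset.Iic n → X) (i : ℕ) : X :=
  y ⟨min i n, Finset.mem_Iic.2 (min_le_right i n)⟩

lemma comp_extendHistory {F : (ℕ → X) → ℝ} {n : ℕ}
    (hF : ∀ ω ω' : ℕ → X, (∀ i ≤ n, ω i = ω' i) → F ω = F ω') (ω : ℕ → X) :
    F (extendHistory n (Preorder.frestrictLe n ω)) = F ω :=
  hF _ _ fun i hi => by simp [extendHistory, hi]

variable [MeasurableSpace X] [DiscreteMeasurableSpace X]

lemma measurableSet_eval_eq (n : ℕ) (y : X) : MeasurableSet {ω : ℕ → X | ω n = y} :=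
  measurable_pi_apply (X := fun _ : ℕ => X) n (MeasurableSet.singleton y)

lemma law_map_zero (μ₀ : PMF X) (P : X → PMF X) :
    (law μ₀ P).map (fun ω => ω 0) = μ₀.toMeasure := by
  have : (fun ω : ℕ → X => ω 0) =
      (fun y : Finset.Iic 0 → X => y ⟨0, by simp⟩) ∘ Preorder.frestrictLe 0 := rfl
  rw [this, ← Measure.map_map (by fun_prop) (by fun_prop), law, Kernel.trajMeasure,
    Measure.map_comp _ _ (by fun_prop), Kernel.traj_map_frestrictLe, Kernel.partialTraj_self,
    Measure.id_comp, Measure.map_map (by fun_prop) (by fun_prop)]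
  exact Measure.map_id

lemma ae_zero_eq (x : X) (P : X → PMF X) : ∀ᵐ ω ∂(law (PMF.pure x) P), ω 0 = x := by
  have h : ∀ᵐ y ∂((law (PMF.pure x) P).map fun ω => ω 0), y = x := by
    rw [law_map_zero, PMF.toMeasure_pure, ae_dirac_eq]
    simp
  exact ae_of_ae_map (measurable_pi_apply 0).aemeasurable h

variable [Fintype X]

lemma measurable_of_depends {F : (ℕ → X) → ℝ} {n : ℕ}
    (hF : ∀ ω ω' : ℕ → X, (∀ i ≤ n, ω i = ω' i) → F ω = F ω') : Measurable F := by
  have : F = (fun y => F (extendHistory n y)) ∘ (Preorder.frestrictLe n) :=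
    funext fun ω => (comp_extendHistory hF ω).symm
  rw [this]
  exact Measurable.of_discrete.comp (by fun_prop)

lemma integrable_of_depends {F : (ℕ → X) → ℝ} {n : ℕ} (μ : Measure (ℕ → X)) [IsFiniteMeasure μ]
    (hF : ∀ ω ω' : ℕ → X, (∀ i ≤ n, ω i = ω' i) → F ω = F ω') : Integrable F μ := by
  obtain ⟨C, hC⟩ := (Set.finite_range fun y => |F (extendHistory n y)|).bddAbove
  refine Integrable.of_bound (measurable_of_depends hF).aestronglyMeasurable C
    (ae_of_all _ fun ω => ?_)
  rw [← comp_extendHistory hF ω]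
  exact hC ⟨_, rfl⟩

/-- The Markov property: the conditional expectation of `h (ω (n + 1))` given the first `n + 1`
states is `stepMean P h (ω n)`. -/
theorem integral_mul_succ (μ₀ : PMF X) (P : X → PMF X) {n : ℕ} {F : (ℕ → X) → ℝ}
    (hF : ∀ ω ω' : ℕ → X, (∀ i ≤ n, ω i = ω' i) → F ω = F ω') (h : X → ℝ) :
    ∫ ω, F ω * h (ω (n + 1)) ∂(law μ₀ P) = ∫ ω, F ω * stepMean P h (ω n) ∂(law μ₀ P) := by
  let G : (Finset.Iic n → X) → ℝ := fun y => F (extendHistory n y)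
  have hG : ∀ ω, G (Preorder.frestrictLe n ω) = F ω := comp_extendHistory hF
  -- The joint law of the history and the next state disintegrates along the transition kernel.
  have hmap := Kernel.map_frestrictLe_trajMeasure_compProd_eq_map_trajMeasure
    (X := fun _ => X) (μ₀ := μ₀.toMeasure) (κ := historyKernel P) (a := n)
  have h1 : ∫ ω, F ω * h (ω (n + 1)) ∂(law μ₀ P) =
      ∫ z, G z.1 * h z.2 ∂((law μ₀ P).map fun ω => (Preorder.frestrictLe n ω, ω (n + 1))) := by
    rw [integral_map (by fun_prop) (by fun_prop)]
    simp only [hG]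
  have hprob : IsProbabilityMeasure ((law μ₀ P).map (Preorder.frestrictLe (π := fun _ => X) n)) :=
    Measure.isProbabilityMeasure_map (by fun_prop)
  rw [h1, law, ← hmap, Measure.integral_compProd (.of_finite)]
  rw [← law, integral_map (by fun_prop) (by fun_prop)]
  refine integral_congr_ae (ae_of_all _ fun ω => ?_)
  simp only [hG, integral_const_mul]
  congr 1
  change ∫ y, h y ∂(P (ω n)).toMeasure = _
  rw [PMF.integral_eq_sum]
  rfl

end MarkovProperty

end MarkovChain

namespace MarkovChain

/-! ### Recurrence from reachability in finite chains -/

section Recurrence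

variable {X : Type*} [Fintype X]

open scoped Classical in
/-- The probability of avoiding `y` at the times `1, …, n`, as a function of the initial state. -/
noncomputable def avoidProb (P : X → PMF X) (y : X) : ℕ → X → ℝ
  | 0 => fun _ => 1
  | n + 1 => stepMean P fun z => if z = y then 0 else avoidProb P y n z

lemma stepMean_mono (P : X → PMF X) {g h : X → ℝ} (hgh : ∀ y, g y ≤ h y) (x : X) :
    stepMean P g x ≤ stepMean P h x :=
  Finset.sum_le_sum fun y _ => mul_le_mul_of_nonneg_left (hgh y) ENNReal.toReal_nonneg

lemma stepMean_const (P : X → PMF X) (c : ℝ) (x : X) : stepMean P (fun _ => c) x = c := by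
  rw [stepMean, ← Finset.sum_mul, sum_toReal_eq_one, one_mul]

lemma avoidProb_nonneg (P : X → PMF X) (y : X) (n : ℕ) (x : X) : 0 ≤ avoidProb P y n x := by
  induction n generalizing x with
  | zero => exact zero_le_one
  | succ n ih =>
    refine (stepMean_const P 0 x).symm.le.trans (stepMean_mono P (fun z => ?_) x)
    split_ifs
    exacts [le_rfl, ih z]

lemma avoidProb_succ_le (P : X → PMF X) (y : X) (n : ℕ) (x : X) :
    avoidProb P y (n + 1) x ≤ avoidProb P y n x := by
  induction n generalizing x with
  | zero =>
    rw [avoidProb, avoidProb, ← stepMean_const P 1 x]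
    refine stepMean_mono P (fun z => ?_) x
    split_ifs
    exacts [zero_le_one, le_rfl]
  | succ n ih =>
    rw [avoidProb, avoidProb]
    refine stepMean_mono P (fun z => ?_) x
    split_ifs
    exacts [le_rfl, ih z]

/-- Maximum principle for the limit `q` of the avoidance probabilities: where `q` attains a positive
maximum over the states reachable from `y`, no step can hit `y` and every successor is again
maximal, which a path back to `y` contradicts. -/
lemma tendsto_avoidProb (P : X → PMF X) {y : X} (hy : ∀ z, Reachable P y z → Reachable P z y) :
    Tendsto (fun n => avoidProb P y n y) atTop (𝓝 0) := by
  classical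
  have hlim : ∀ x, ∃ l, Tendsto (fun n => avoidProb P y n x) atTop (𝓝 l) := fun x =>
    ⟨_, tendsto_atTop_ciInf (antitone_nat_of_succ_le fun n => avoidProb_succ_le P y n x)
      ⟨0, by rintro _ ⟨n, rfl⟩; exact avoidProb_nonneg P y n x⟩⟩
  choose q hq using hlim
  have hq0 : ∀ x, 0 ≤ q x := fun x =>
    ge_of_tendsto' (hq x) fun n => avoidProb_nonneg P y n x
  have hfix : ∀ x, q x = stepMean P (fun z => if z = y then 0 else q z) x := by
    intro x
    refine tendsto_nhds_unique ((tendsto_add_atTop_iff_nat 1).2 (hq x)) ?_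
    simp only [avoidProb, stepMean]
    refine tendsto_finsetSum _ fun z _ => Tendsto.const_mul _ ?_
    split_ifs
    exacts [tendsto_const_nhds, hq z]
  obtain ⟨x, hx, hmax⟩ := Set.exists_max_image {z | Reachable P y z} q (Set.toFinite _)
    ⟨y, Relation.ReflTransGen.refl⟩
  suffices h : q x = 0 by
    have := hq y
    rwa [le_antisymm (h ▸ hmax y Relation.ReflTransGen.refl) (hq0 y)] at this
  by_contra hne
  have hpos : 0 < q x := lt_of_le_of_ne (hq0 x) (Ne.symm hne)
  have step : ∀ z w, Reachable P y z → q z = q x → 0 < P z w → w ≠ y ∧ q w = q x := by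
    intro z w hz hzx hzw
    have := eq_of_average_eq (P z) (h := fun z => if z = y then 0 else q z) (m := q x)
      (fun v hv => by
        split_ifs
        exacts [hpos.le, hmax v (hz.tail hv)])
      (by rw [← hzx]; exact (hfix z).le) hzw
    split_ifs at this with hwy
    exacts [absurd this.symm hne, ⟨hwy, this⟩]
  have prop : ∀ z w, Reachable P y z → q z = q x → Reachable P z w → q w = q x := by
    intro z w hz hzx hzw
    induction hzw with
    | refl => exact hzx
    | tail h1 h2 ih => exact (step _ _ (hz.trans h1) ih h2).2
  have hyx : q y = q x := prop x y hx rfl (hy x hx)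
  -- The path from `x` to `y` may be empty, so leave `y` by one step and return: the last step of
  -- the return enters `y` from a maximal state.
  obtain ⟨w, hw⟩ := (P y).support_nonempty
  have hyw : 0 < P y w := pos_iff_ne_zero.2 hw
  have hback := hy w (Relation.ReflTransGen.single hyw)
  obtain ⟨hwy, hwx⟩ := step y w Relation.ReflTransGen.refl hyx hyw
  rcases Relation.ReflTransGen.cases_tail hback with h | ⟨v, hv, hvy⟩
  · exact hwy h.symm
  · have hyv : Reachable P y v := Relation.ReflTransGen.head hyw hv
    exact (step v y hyv (prop w v (.single hyw) hwx hv) hvy).1 rfl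

variable [MeasurableSpace X] [DiscreteMeasurableSpace X]

-- The Markov property moves the avoidance constraint at the last time into `avoidProb`, one time at
-- a time. The case `m = 0` identifies `avoidProb` with an actual probability.
open scoped Classical in
lemma integral_avoid_mul (μ₀ : PMF X) (P : X → PMF X) (y : X) (j m : ℕ) :
    ∫ ω, (if ∀ i, 1 ≤ i → i ≤ j → ω i ≠ y then 1 else 0) * avoidProb P y m (ω j) ∂(law μ₀ P) =
      ∫ ω, avoidProb P y (m + j) (ω 0) ∂(law μ₀ P) := by
  induction j generalizing m with
  | zero =>
    refine integral_congr_ae (ae_of_all _ fun ω => ?_)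
    have : ∀ i, 1 ≤ i → i ≤ 0 → ω i ≠ y := fun i h1 h2 => by omega
    dsimp only
    rw [if_pos this, one_mul, add_zero]
  | succ j ih =>
    rw [show m + (j + 1) = (m + 1) + j by ring, ← ih (m + 1), avoidProb,
      ← integral_mul_succ μ₀ P (n := j)
        (F := fun ω => if ∀ i, 1 ≤ i → i ≤ j → ω i ≠ y then 1 else 0)]
    · refine integral_congr_ae (ae_of_all _ fun ω => ?_)
      have : (∀ i, 1 ≤ i → i ≤ j + 1 → ω i ≠ y) ↔
          (∀ i, 1 ≤ i → i ≤ j → ω i ≠ y) ∧ ω (j + 1) ≠ y := by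
        refine ⟨fun h => ⟨fun i h1 h2 => h i h1 (by omega), h _ (by omega) le_rfl⟩, ?_⟩
        rintro ⟨h, h'⟩ i h1 h2
        rcases Nat.le_succ_iff.1 h2 with h3 | rfl
        exacts [h i h1 h3, h']
      dsimp only
      by_cases hA : ∀ i, 1 ≤ i → i ≤ j → ω i ≠ y
      · by_cases hB : ω (j + 1) = y
        · rw [if_neg fun h => (this.1 h).2 hB, if_pos hB, zero_mul, mul_zero]
        · rw [if_pos (this.2 ⟨hA, hB⟩), if_pos hA, if_neg hB]
      · rw [if_neg fun h => hA (this.1 h).1, if_neg hA, zero_mul, zero_mul]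
    · intro ω ω' h
      have : (∀ i, 1 ≤ i → i ≤ j → ω i ≠ y) ↔ (∀ i, 1 ≤ i → i ≤ j → ω' i ≠ y) :=
        forall_congr' fun i => imp_congr_right fun _ => forall_congr' fun hi => by rw [h i hi]
      by_cases hA : ∀ i, 1 ≤ i → i ≤ j → ω i ≠ y
      · rw [if_pos hA, if_pos (this.1 hA)]
      · rw [if_neg hA, if_neg fun h' => hA (this.2 h')]

/-- A state of a finite chain is recurrent if it can be reached back from wherever it leads. -/
theorem isRecurrent_of_reachable (P : X → PMF X) {y : X}
    (hy : ∀ z, Reachable P y z → Reachable P z y) : IsRecurrent P y := by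
  classical
  have hmeas : MeasurableSet {ω : ℕ → X | ∃ n, 1 ≤ n ∧ ω n = y} := by
    have : {ω : ℕ → X | ∃ n, 1 ≤ n ∧ ω n = y} = ⋃ (n : ℕ) (_ : 1 ≤ n), {ω | ω n = y} := by
      ext ω
      simp
    rw [this]
    exact MeasurableSet.iUnion fun n => MeasurableSet.iUnion fun _ => measurableSet_eval_eq n y
  rw [IsRecurrent, ← prob_compl_eq_zero_iff hmeas, ← measureReal_eq_zero_iff]
  refine le_antisymm (ge_of_tendsto' (tendsto_avoidProb P hy) fun j => ?_) measureReal_nonneg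
  have hset : MeasurableSet {ω : ℕ → X | ∀ i, 1 ≤ i → i ≤ j → ω i ≠ y} := by
    simp only [Set.ofPred_forall]
    exact MeasurableSet.iInter fun i => MeasurableSet.iInter fun _ => MeasurableSet.iInter fun _ =>
      (measurableSet_eval_eq i y).compl
  calc (law (PMF.pure y) P).real {ω | ∃ n, 1 ≤ n ∧ ω n = y}ᶜ
      ≤ (law (PMF.pure y) P).real {ω | ∀ i, 1 ≤ i → i ≤ j → ω i ≠ y} :=
        measureReal_mono fun ω hω i h1 _ h => hω ⟨i, h1, h⟩
    _ = ∫ ω, (if ∀ i, 1 ≤ i → i ≤ j → ω i ≠ y then 1 else 0) * avoidProb P y 0 (ω j)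
          ∂(law (PMF.pure y) P) := by
        rw [← integral_indicator_one hset]
        refine integral_congr_ae (ae_of_all _ fun ω => ?_)
        simp [Set.indicator_apply, avoidProb]
    _ = ∫ ω, avoidProb P y j y ∂(law (PMF.pure y) P) := by
        rw [integral_avoid_mul, zero_add]
        exact integral_congr_ae ((ae_zero_eq y P).mono fun ω hω => by simp only [hω])
    _ = avoidProb P y j y := by simp

/-- A nonempty closed set of states of a finite chain contains a recurrent class. -/
theorem exists_isRecurrentClass (P : X → PMF X) {D : Set X} (hD : D.Nonempty)
    (hclosed : ∀ x ∈ D, ∀ y, 0 < P x y → y ∈ D) :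
    ∃ x ∈ D, IsRecurrentClass P (commClass P x) := by
  -- A state with the fewest reachable states is reachable from everything it leads to, since
  -- reachable sets only shrink along paths.
  obtain ⟨x, hx, hmin⟩ := Set.exists_min_image D (fun x => {z | Reachable P x z}.ncard)
    (Set.toFinite _) hD
  have hmem : ∀ z, Reachable P x z → z ∈ D := by
    intro z hz
    induction hz with
    | refl => exact hx
    | tail _ h ih => exact hclosed _ ih _ h
  have heq : ∀ z, Reachable P x z → {w | Reachable P z w} = {w | Reachable P x w} := fun z hz =>
    Set.eq_of_subset_of_ncard_le (fun w hw => hz.trans hw) (hmin z (hmem z hz)) (Set.toFinite _)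
  refine ⟨x, hx, ⟨x, rfl⟩, fun y hy => isRecurrent_of_reachable P fun z hz => ?_⟩
  have : y ∈ {w | Reachable P z w} := by rw [heq z (hy.1.trans hz)]; exact hy.1
  exact this

end Recurrence

/-! ### Poisson equation and strong law of large numbers -/

section Ergodic

variable {X : Type*} [Fintype X]

/-- The Poisson equation is solvable when the only harmonic functions are the constants. -/
theorem exists_poisson [Nonempty X] (P : X → PMF X)
    (hP : ∀ h : X → ℝ, (∀ x, stepMean P h x = h x) → ∀ x y, h x = h y) (g : X → ℝ) :
    ∃ (c : ℝ) (h : X → ℝ), ∀ x, g x = c + (h x - stepMean P h x) := by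
  let L : (X → ℝ) →ₗ[ℝ] (X → ℝ) :=
    { toFun := fun h x => h x - stepMean P h x
      map_add' := fun h k => by
        ext x
        simp only [stepMean, Pi.add_apply, mul_add, Finset.sum_add_distrib]
        ring
      map_smul' := fun r h => by
        ext x
        simp only [stepMean, Pi.smul_apply, smul_eq_mul, RingHom.id_apply, mul_sub,
          Finset.mul_sum]
        congr 1
        exact Finset.sum_congr rfl fun y _ => by ring }
  have hker : LinearMap.ker L ≤ ℝ ∙ (1 : X → ℝ) := by
    intro h hh
    have hx0 := hP h fun x => by
      have := congrFun (LinearMap.mem_ker.1 hh) x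
      simp only [L, LinearMap.coe_mk, AddHom.coe_mk, Pi.zero_apply] at this
      linarith
    rw [Submodule.mem_span_singleton]
    exact ⟨h (Classical.arbitrary X), funext fun x => by simp [hx0 x (Classical.arbitrary X)]⟩
  -- At a minimum of `h` the value of `h - P h` is at most `0`, so it cannot be `1`.
  have hone : (1 : X → ℝ) ∉ LinearMap.range L := by
    rintro ⟨h, hh⟩
    obtain ⟨x, hx⟩ := Finite.exists_min h
    have h1 := congrFun hh x
    simp only [L, LinearMap.coe_mk, AddHom.coe_mk, Pi.one_apply] at h1
    have h2 := stepMean_mono P hx x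
    rw [stepMean_const] at h2
    linarith
  have hdisj : Disjoint (LinearMap.range L) (ℝ ∙ (1 : X → ℝ)) :=
    (Submodule.disjoint_span_singleton' one_ne_zero).2 hone
  -- Rank-nullity: the kernel lies in the line of constants, so the range and that line, being
  -- disjoint, have enough dimension to fill the space.
  have htop : LinearMap.range L ⊔ (ℝ ∙ (1 : X → ℝ)) = ⊤ := by
    refine Submodule.eq_top_of_disjoint _ _ ?_ hdisj
    rw [← L.finrank_range_add_finrank_ker]
    exact Nat.add_le_add_left (Submodule.finrank_mono hker) _
  obtain ⟨u, ⟨h, rfl⟩, v, hv, huv⟩ := Submodule.mem_sup.1 (htop ▸ Submodule.mem_top (x := g))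
  obtain ⟨c, rfl⟩ := Submodule.mem_span_singleton.1 hv
  refine ⟨c, h, fun x => ?_⟩
  have := congrFun huv x
  simp only [L, LinearMap.coe_mk, AddHom.coe_mk, Pi.add_apply, Pi.smul_apply, Pi.one_apply,
    smul_eq_mul, mul_one] at this
  linarith

/-- The martingale with increments `h (ω (t + 1)) - stepMean P h (ω t)`. -/
noncomputable def stepMartingale (P : X → PMF X) (h : X → ℝ) (n : ℕ) (ω : ℕ → X) : ℝ :=
  ∑ t ∈ Finset.range n, (h (ω (t + 1)) - stepMean P h (ω t))

lemma stepMartingale_congr (P : X → PMF X) (h : X → ℝ) (n : ℕ) (ω ω' : ℕ → X)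
    (hω : ∀ i ≤ n, ω i = ω' i) : stepMartingale P h n ω = stepMartingale P h n ω' := by
  refine Finset.sum_congr rfl fun t ht => ?_
  have := Finset.mem_range.1 ht
  rw [hω t (by omega), hω (t + 1) (by omega)]

variable [MeasurableSpace X] [DiscreteMeasurableSpace X]

/-- Martingale increments are orthogonal to the past, so the cross term vanishes and each step adds
at most the bound `B` on a squared increment. -/
lemma exists_integral_stepMartingale_sq_le (μ₀ : PMF X) (P : X → PMF X) (h : X → ℝ) :
    ∃ B : ℝ, 0 ≤ B ∧ ∀ n, ∫ ω, stepMartingale P h n ω ^ 2 ∂(law μ₀ P) ≤ n * B := by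
  obtain ⟨B, hB⟩ := (Set.finite_range fun z : X × X => (h z.2 - stepMean P h z.1) ^ 2).bddAbove
  have hB' : ∀ x y, (h y - stepMean P h x) ^ 2 ≤ B := fun x y => hB ⟨(x, y), rfl⟩
  obtain ⟨x₀, -⟩ := μ₀.support_nonempty
  refine ⟨B, (sq_nonneg _).trans (hB' x₀ x₀), fun n => ?_⟩
  induction n with
  | zero => simp [stepMartingale]
  | succ n ih =>
    let S := stepMartingale P h n
    have hS : ∀ ω ω' : ℕ → X, (∀ i ≤ n, ω i = ω' i) → S ω = S ω' := stepMartingale_congr P h n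
    have i1 : Integrable (fun ω => S ω ^ 2) (law μ₀ P) :=
      integrable_of_depends (n := n) _ fun ω ω' hω => by rw [hS ω ω' hω]
    have i2 : Integrable (fun ω => S ω * h (ω (n + 1))) (law μ₀ P) :=
      integrable_of_depends (n := n + 1) _ fun ω ω' hω => by
        rw [hS ω ω' fun i hi => hω i (by omega), hω (n + 1) le_rfl]
    have i3 : Integrable (fun ω => S ω * stepMean P h (ω n)) (law μ₀ P) :=
      integrable_of_depends (n := n) _ fun ω ω' hω => by rw [hS ω ω' hω, hω n le_rfl]
    have i4 : Integrable (fun ω => (h (ω (n + 1)) - stepMean P h (ω n)) ^ 2) (law μ₀ P) :=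
      integrable_of_depends (n := n + 1) _ fun ω ω' hω => by
        rw [hω n (by omega), hω (n + 1) le_rfl]
    have hexp : ∀ ω, stepMartingale P h (n + 1) ω ^ 2 = S ω ^ 2 +
        2 * (S ω * h (ω (n + 1)) - S ω * stepMean P h (ω n)) +
        (h (ω (n + 1)) - stepMean P h (ω n)) ^ 2 := fun ω => by
      rw [stepMartingale, Finset.sum_range_succ]
      simp only [S, stepMartingale]
      ring
    have i5 : Integrable (fun ω => 2 * (S ω * h (ω (n + 1)) - S ω * stepMean P h (ω n)))
      (law μ₀ P) := (i2.sub i3).const_mul 2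
    have i6 : Integrable (fun ω => S ω ^ 2 +
      2 * (S ω * h (ω (n + 1)) - S ω * stepMean P h (ω n))) (law μ₀ P) := i1.add i5
    simp only [hexp]
    rw [integral_add i6 i4, integral_add i1 i5, integral_const_mul, integral_sub i2 i3,
      integral_mul_succ μ₀ P hS h, sub_self, mul_zero, add_zero]
    have h4 : ∫ ω, (h (ω (n + 1)) - stepMean P h (ω n)) ^ 2 ∂(law μ₀ P) ≤ B := by
      calc _ ≤ ∫ _, B ∂(law μ₀ P) :=
            integral_mono i4 (integrable_const B) fun ω => hB' _ _
        _ = B := by simp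
    push_cast
    linarith

/-- At time `N ^ 2` the normalized second moment is at most `B / N ^ 2`, which is summable; along
all times the bound `B / n` would not be. -/
lemma ae_tendsto_stepMartingale_sq (μ₀ : PMF X) (P : X → PMF X) (h : X → ℝ) :
    ∀ᵐ ω ∂(law μ₀ P), Tendsto
      (fun n : ℕ => stepMartingale P h ((n + 1) ^ 2) ω / ((n + 1 : ℕ) : ℝ) ^ 2) atTop (𝓝 0) := by
  obtain ⟨B, hB0, hB⟩ := exists_integral_stepMartingale_sq_le μ₀ P h
  let Z : ℕ → (ℕ → X) → ℝ := fun n ω =>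
    (stepMartingale P h ((n + 1) ^ 2) ω / ((n + 1 : ℕ) : ℝ) ^ 2) ^ 2
  have hdep : ∀ n, ∀ ω ω' : ℕ → X, (∀ i ≤ (n + 1) ^ 2, ω i = ω' i) → Z n ω = Z n ω' :=
    fun n ω ω' hω => by simp only [Z, stepMartingale_congr P h _ ω ω' hω]
  have hZ : ∀ n, ∫ ω, Z n ω ∂(law μ₀ P) ≤ B * (1 / ((n + 1 : ℕ) : ℝ) ^ 2) := by
    intro n
    have hpos : (0 : ℝ) < ((n + 1 : ℕ) : ℝ) := by positivity
    simp only [Z, div_pow, integral_div]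
    rw [div_le_iff₀ (by positivity)]
    refine (hB _).trans (le_of_eq ?_)
    push_cast
    field_simp
  have hsum : Summable fun n : ℕ => B * (1 / ((n + 1 : ℕ) : ℝ) ^ 2) :=
    ((summable_nat_add_iff 1).2 (Real.summable_one_div_nat_pow.2 one_lt_two)).mul_left B
  have hlint : ∫⁻ ω, ∑' n, ENNReal.ofReal (Z n ω) ∂(law μ₀ P) ≠ ⊤ := by
    rw [lintegral_tsum fun n => (measurable_of_depends (hdep n)).ennreal_ofReal.aemeasurable]
    refine ne_top_of_le_ne_top hsum.tsum_ofReal_ne_top (ENNReal.tsum_le_tsum fun n => ?_)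
    rw [← ofReal_integral_eq_lintegral_ofReal (integrable_of_depends _ (hdep n))
      (ae_of_all _ fun ω => sq_nonneg _)]
    exact ENNReal.ofReal_le_ofReal (hZ n)
  have hae := ae_lt_top (Measurable.tsum
    fun n => (measurable_of_depends (hdep n)).ennreal_ofReal) hlint
  filter_upwards [hae] with ω hω
  have h1 := ENNReal.tendsto_atTop_zero_of_tsum_ne_top hω.ne
  have h2 : Tendsto (fun n => Z n ω) atTop (𝓝 0) := by
    have := (ENNReal.tendsto_toReal ENNReal.zero_ne_top).comp h1
    simpa [Function.comp_def, ENNReal.toReal_ofReal, Z, sq_nonneg] using this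
  have h3 := h2.sqrt
  simp only [Z, Real.sqrt_sq_eq_abs, Real.sqrt_zero] at h3
  exact (tendsto_zero_iff_abs_tendsto_zero _).2 h3

open scoped Classical in
/-- The strong law of large numbers for a finite Markov chain whose only harmonic functions are
the constants. -/
theorem exists_ae_tendsto_visits (P : X → PMF X)
    (hP : ∀ h : X → ℝ, (∀ x, stepMean P h x = h x) → ∀ x y, h x = h y) (x : X) :
    ∃ c : ℝ, ∀ μ₀ : PMF X, ∀ᵐ ω ∂(law μ₀ P), Tendsto
      (fun n : ℕ => (∑ t ∈ Finset.range n, if ω t = x then (1 : ℝ) else 0) / n) atTop (𝓝 c) := by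
  have : Nonempty X := ⟨x⟩
  obtain ⟨c, h, hpoisson⟩ := exists_poisson P hP fun y => if y = x then 1 else 0
  refine ⟨c, fun μ₀ => ?_⟩
  obtain ⟨C, hC⟩ := (Set.finite_range fun z : X × X => |h z.1 - h z.2|).bddAbove
  filter_upwards [ae_tendsto_stepMartingale_sq μ₀ P h] with ω hω
  -- Sum the Poisson equation along the path, inserting `h (ω (t + 1))` in each term.
  have hdecomp : ∀ n : ℕ, (∑ t ∈ Finset.range n, if ω t = x then (1 : ℝ) else 0) =
      n * c + (h (ω 0) - h (ω n)) + stepMartingale P h n ω := by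
    intro n
    induction n with
    | zero => simp [stepMartingale]
    | succ n ih =>
      rw [Finset.sum_range_succ, ih, hpoisson (ω n), stepMartingale, stepMartingale,
        Finset.sum_range_succ]
      push_cast
      ring
  -- Visit counts are monotone and ratios of consecutive squares tend to `1`, so convergence along
  -- squares suffices.
  refine tendsto_div_of_monotone_of_exists_subseq_tendsto_div _ c ?_ fun a ha =>
    ⟨fun n => (n + 1) ^ 2, ?_, ?_, ?_⟩
  · refine monotone_nat_of_le_succ fun n => ?_
    rw [Finset.sum_range_succ]
    split_ifs <;> simp
  · have h1 : Tendsto (fun n : ℕ => (1 + 1 / ((n : ℝ) + 1)) ^ 2) atTop (𝓝 ((1 + 0) ^ 2)) :=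
      (tendsto_const_nhds.add tendsto_one_div_add_atTop_nhds_zero_nat).pow 2
    filter_upwards [h1.eventually (gt_mem_nhds (by simpa using ha))] with n hn
    have hpos : (0 : ℝ) < (n : ℝ) + 1 := by positivity
    have : (((n + 1 + 1) ^ 2 : ℕ) : ℝ) = (1 + 1 / ((n : ℝ) + 1)) ^ 2 * ((n : ℝ) + 1) ^ 2 := by
      rw [← mul_pow]
      push_cast
      congr 1
      field_simp
    rw [this]
    push_cast
    exact mul_le_mul_of_nonneg_right hn.le (sq_nonneg _)
  · exact (tendsto_pow_atTop two_ne_zero).comp (tendsto_add_atTop_nat 1)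
  · have hbdd : Tendsto (fun n : ℕ => (h (ω 0) - h (ω ((n + 1) ^ 2))) / ((n + 1 : ℕ) : ℝ) ^ 2)
        atTop (𝓝 0) := by
      refine squeeze_zero_norm (a := fun n : ℕ => C / ((n + 1 : ℕ) : ℝ) ^ 2) (fun n => ?_) ?_
      · rw [Real.norm_eq_abs, abs_div, abs_of_nonneg (sq_nonneg ((n + 1 : ℕ) : ℝ))]
        exact div_le_div_of_nonneg_right (hC ⟨(ω 0, ω ((n + 1) ^ 2)), rfl⟩) (sq_nonneg _)
      · exact tendsto_const_nhds.div_atTop ((tendsto_pow_atTop two_ne_zero).comp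
          (tendsto_natCast_atTop_atTop.comp (tendsto_add_atTop_nat 1)))
    have hsum := (tendsto_const_nhds (x := c)).add (hbdd.add hω)
    simp only [add_zero] at hsum
    refine hsum.congr fun n => ?_
    rw [hdecomp]
    have hpos : (n : ℝ) + 1 ≠ 0 := by positivity
    push_cast
    field_simp
    ring

end Ergodic

end MarkovChain

namespace GUMDP

/-! ### Harmonic functions of a unichain process -/

section Harmonic

variable {S A : Type*}

lemma withAction_apply (π : S → PMF A) (μ : PMF S) (x : S × A) :
    withAction π μ x = μ x.1 * π x.1 x.2 := by
  classical
  obtain ⟨s, a⟩ := x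
  rw [withAction, PMF.bind_apply, tsum_eq_single s]
  · congr 1
    rw [PMF.map_apply, tsum_eq_single a]
    · simp
    · intro b hb
      simp [hb.symm]
  · intro t ht
    have : (PMF.map (Prod.mk t) (π t)) (s, a) = 0 := by
      rw [PMF.map_apply]
      simp [ht.symm]
    rw [this, mul_zero]

variable [Fintype S] [Fintype A] (M : GUMDP S A)

/-- The expectation of `h` over the action taken in a state. -/
noncomputable def actionMean (π : S → PMF A) (h : S × A → ℝ) (s : S) : ℝ :=
  ∑ a, (π s a).toReal * h (s, a)

lemma stepMean_withAction (π : S → PMF A) (h : S × A → ℝ) (x : S × A) :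
    MarkovChain.stepMean (fun x => withAction π (M.p x.1 x.2)) h x =
      ∑ s, (M.p x.1 x.2 s).toReal * actionMean π h s := by
  simp only [MarkovChain.stepMean, withAction_apply, Fintype.sum_prod_type, ENNReal.toReal_mul,
    actionMean, Finset.mul_sum, mul_assoc]

variable [MeasurableSpace S] [DiscreteMeasurableSpace S]

/-- In a unichain process the harmonic functions of every stationary policy are constant. -/
lemma IsUnichain.eq_of_harmonic {M : GUMDP S A} (hM : M.IsUnichain) (π : S → PMF A) {g : S → ℝ}
    (hg : ∀ s, ∑ a, (π s a).toReal * ∑ s', (M.p s a s').toReal * g s' = g s) (s t : S) :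
    g s = g t := by
  have : Nonempty S := ⟨s⟩
  obtain ⟨u, hu⟩ := Finite.exists_max g
  obtain ⟨v, hv⟩ := Finite.exists_min g
  choose δ hδ using fun s => (π s).support_nonempty
  have hδ' : ∀ s, 0 < π s (δ s) := fun s => pos_iff_ne_zero.2 (hδ s)
  -- The maximum principle applies twice: to the average over actions, which singles out `δ s`, then
  -- to the average over successors.
  have closed : ∀ (k : S → ℝ) (m : ℝ), (∀ s, k s ≤ m) →
      (∀ s, ∑ a, (π s a).toReal * ∑ s', (M.p s a s').toReal * k s' = k s) →
      ∀ s ∈ {s | k s = m}, ∀ s', 0 < M.stateStep (fun s => PMF.pure (δ s)) s s' →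
        s' ∈ {s | k s = m} := by
    intro k m hk hkh s hs s' hs'
    rw [stateStep, PMF.pure_bind] at hs'
    have hle : ∀ a, ∑ s', (M.p s a s').toReal * k s' ≤ m := fun a => by
      calc _ ≤ ∑ s', (M.p s a s').toReal * m :=
            Finset.sum_le_sum fun y _ => mul_le_mul_of_nonneg_left (hk y) ENNReal.toReal_nonneg
        _ = m := by rw [← Finset.sum_mul, MarkovChain.sum_toReal_eq_one, one_mul]
    have h1 := MarkovChain.eq_of_average_eq (π s) (m := m) (fun a _ => hle a)
      (by rw [hkh s]; exact (show k s = m from hs).ge) (hδ' s)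
    exact MarkovChain.eq_of_average_eq _ (fun y _ => hk y) h1.ge hs'
  have cmax := closed g (g u) hu hg
  have cmin := closed (fun s => -g s) (-g v) (fun s => neg_le_neg (hv s)) fun s => by
    simp only [mul_neg, Finset.sum_neg_distrib, hg]
  obtain ⟨x, hx, hxC⟩ := MarkovChain.exists_isRecurrentClass _ (D := {s | g s = g u}) ⟨u, rfl⟩ cmax
  obtain ⟨y, hy, hyC⟩ := MarkovChain.exists_isRecurrentClass _ (D := {s | -g s = -g v}) ⟨v, rfl⟩ cmin
  have hmem : y ∈ MarkovChain.commClass (M.stateStep fun s => PMF.pure (δ s)) x := by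
    rw [(hM δ).unique hxC hyC]
    exact ⟨Relation.ReflTransGen.refl, Relation.ReflTransGen.refl⟩
  have hyu : g y = g u := by
    have : ∀ z, MarkovChain.Reachable (M.stateStep fun s => PMF.pure (δ s)) x z → g z = g u := by
      intro z hz
      induction hz with
      | refl => exact hx
      | tail _ h ih => exact cmax _ ih _ h
    exact this y hmem.1
  have hyv : g y = g v := neg_injective hy
  have huv : g u = g v := hyu.symm.trans hyv
  linarith [hu s, hv s, hu t, hv t]

/-- Averaging `h` over actions gives a harmonic function on states, hence a constant; `h` is
recovered from it by averaging over the next state. -/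
lemma IsUnichain.eq_of_stepMean_eq {M : GUMDP S A} (hM : M.IsUnichain) (π : S → PMF A)
    {h : S × A → ℝ}
    (hh : ∀ x, MarkovChain.stepMean (fun x => withAction π (M.p x.1 x.2)) h x = h x)
    (x y : S × A) : h x = h y := by
  simp only [stepMean_withAction] at hh
  have hg := hM.eq_of_harmonic π (g := actionMean π h) fun s => by
    conv_rhs => rw [actionMean]
    exact Finset.sum_congr rfl fun a _ => by rw [← hh (s, a)]
  have hconst : ∀ z, h z = actionMean π h x.1 := fun z => by
    rw [← hh z, Finset.sum_congr rfl fun s _ => by rw [hg s x.1], ← Finset.sum_mul,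
      MarkovChain.sum_toReal_eq_one, one_mul]
  rw [hconst x, hconst y]

end Harmonic

/-! ### Convergence of empirical and mean frequencies -/

section Occupancy

variable {S A : Type*}

lemma empFreq_nonneg (T : ℕ → S × A) (x : S × A) (H : ℕ) : 0 ≤ empFreq T x H := by
  classical
  exact mul_nonneg (by positivity) (Finset.sum_nonneg fun t _ => by split_ifs <;> simp)

lemma empFreq_le_one (T : ℕ → S × A) (x : S × A) (H : ℕ) : empFreq T x H ≤ 1 := by
  classical
  rw [empFreq, one_div_mul_eq_div]
  refine div_le_one_of_le₀ ?_ (Nat.cast_nonneg H)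
  calc _ ≤ ∑ t ∈ Finset.range H, (1 : ℝ) := Finset.sum_le_sum fun t _ => by split_ifs <;> simp
    _ = H := by simp

variable [Fintype S] [Fintype A]

lemma sum_empFreq (T : ℕ → S × A) {H : ℕ} (hH : H ≠ 0) : ∑ x, empFreq T x H = 1 := by
  classical
  simp only [empFreq, ← Finset.mul_sum]
  rw [Finset.sum_comm]
  simp [hH]

lemma mem_stdSimplex_of_tendsto_empFreq {T : ℕ → S × A} {d : S × A → ℝ}
    (hd : ∀ x, Tendsto (empFreq T x) atTop (𝓝 (d x))) : d ∈ stdSimplex ℝ (S × A) := by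
  refine ⟨fun x => ge_of_tendsto' (hd x) fun H => empFreq_nonneg T x H, ?_⟩
  refine tendsto_nhds_unique (tendsto_finsetSum Finset.univ fun x _ => hd x) ?_
  refine tendsto_const_nhds.congr' ?_
  -- At `H = 0` the frequencies are all `0` and do not sum to one.
  filter_upwards [eventually_ne_atTop 0] with H hH
  exact (sum_empFreq T hH).symm

variable [MeasurableSpace S] [DiscreteMeasurableSpace S]
  [MeasurableSpace A] [DiscreteMeasurableSpace A]

lemma measurable_empFreq (x : S × A) (H : ℕ) :
    Measurable fun T : ℕ → S × A => empFreq T x H := by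
  classical
  refine Measurable.const_mul (Finset.measurable_sum _ fun t _ => ?_) _
  exact Measurable.ite (MarkovChain.measurableSet_eval_eq t x) measurable_const
    measurable_const

lemma meanFreq_eq_integral (M : GUMDP S A) (π : S → PMF A) (x : S × A) (H : ℕ) :
    M.meanFreq π x H = ∫ T, empFreq T x H ∂(M.trajLaw π) := by
  classical
  have hm : ∀ t : ℕ, MeasurableSet {T : ℕ → S × A | T t = x} := fun t =>
    MarkovChain.measurableSet_eval_eq t x
  have hind : ∀ t : ℕ, (fun T : ℕ → S × A => if T t = x then (1 : ℝ) else 0) =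
      {T : ℕ → S × A | T t = x}.indicator 1 := fun t => by
    ext T
    simp [Set.indicator_apply]
  simp only [meanFreq, empFreq]
  rw [integral_const_mul, integral_finsetSum]
  · congr 1
    refine Finset.sum_congr rfl fun t _ => ?_
    rw [hind, integral_indicator_one (hm t)]
  · intro t _
    rw [hind]
    exact (integrable_const (1 : ℝ)).indicator (hm t)

/-- In a unichain process the empirical frequencies converge almost surely, and the mean
frequencies converge, to the same deterministic occupancy. -/
theorem IsUnichain.exists_tendsto {M : GUMDP S A} (hM : M.IsUnichain) (π : S → PMF A) :
    ∃ d ∈ stdSimplex ℝ (S × A), (∀ x, Tendsto (M.meanFreq π x) atTop (𝓝 (d x))) ∧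
      ∀ᵐ T ∂(M.trajLaw π), ∀ x, Tendsto (empFreq T x) atTop (𝓝 (d x)) := by
  choose d hd using MarkovChain.exists_ae_tendsto_visits
    (fun x : S × A => withAction π (M.p x.1 x.2)) fun h hh => hM.eq_of_stepMean_eq π hh
  have hae : ∀ᵐ T ∂(M.trajLaw π), ∀ x, Tendsto (empFreq T x) atTop (𝓝 (d x)) := by
    refine ae_all_iff.2 fun x => ?_
    filter_upwards [hd x (withAction π M.p₀)] with T hT
    refine hT.congr fun H => ?_
    rw [empFreq, one_div_mul_eq_div]
    congr!
  -- As `d` is deterministic, one typical trajectory suffices to place it in the simplex.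
  obtain ⟨T₀, hT₀⟩ := hae.exists
  refine ⟨d, mem_stdSimplex_of_tendsto_empFreq hT₀, fun x => ?_, hae⟩
  have hlim := tendsto_integral_of_dominated_convergence (μ := M.trajLaw π)
    (F := fun H T => empFreq T x H) (f := fun _ => d x) (fun _ => 1)
    (fun H => (measurable_empFreq x H).aestronglyMeasurable) (integrable_const 1)
    (fun H => ae_of_all _ fun T => by
      rw [Real.norm_eq_abs, abs_of_nonneg (empFreq_nonneg T x H)]
      exact empFreq_le_one T x H)
    (hae.mono fun T hT => hT x)
  rw [integral_const, probReal_univ, one_smul] at hlim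
  exact hlim.congr fun H => (meanFreq_eq_integral M π x H).symm

instance (M : GUMDP S A) (π : S → PMF A) (K : ℕ) : IsProbabilityMeasure (M.trialsLaw π K) :=
  inferInstanceAs (IsProbabilityMeasure (Measure.pi _))

lemma ae_trialsLaw_forall (M : GUMDP S A) (π : S → PMF A) (K : ℕ) {p : (ℕ → S × A) → Prop}
    (hp : ∀ᵐ T ∂(M.trajLaw π), p T) : ∀ᵐ T ∂(M.trialsLaw π K), ∀ k, p (T k) :=
  ae_all_iff.2 fun k =>
    (Measure.quasiMeasurePreserving_eval (μ := fun _ : Fin K => M.trajLaw π) k).ae hp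

end Occupancy

end GUMDP

/-- The first four conjuncts say that the limits in the definitions of `d_π` and of the empirical
occupancy exist (almost surely) and give elements of the domain of `f`; the fifth says that the
expectation exists. -/
theorem theorem4 {S A : Type*} [Fintype S] [Fintype A]
    [MeasurableSpace S] [DiscreteMeasurableSpace S]
    [MeasurableSpace A] [DiscreteMeasurableSpace A]
    (M : GUMDP S A) (hM : M.IsUnichain)
    (hf_cont : Continuous M.f) (hf_bdd : ∃ C : ℝ, ∀ d, |M.f d| ≤ C)
    (π : S → PMF A) (K : ℕ) (hK : 1 ≤ K) :
    (∀ x, ∃ l, Filter.Tendsto (M.meanFreq π x) Filter.atTop (nhds l)) ∧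
    M.occupancy π ∈ stdSimplex ℝ (S × A) ∧
    (∀ᵐ T ∂(M.trialsLaw π K), ∀ k x, ∃ l,
      Filter.Tendsto (GUMDP.empFreq (T k) x) Filter.atTop (nhds l)) ∧
    (∀ᵐ T ∂(M.trialsLaw π K), GUMDP.empOccupancyK T ∈ stdSimplex ℝ (S × A)) ∧
    MeasureTheory.Integrable (fun T => M.utility (GUMDP.empOccupancyK T)) (M.trialsLaw π K) ∧
    M.finiteTrials K π = M.infiniteTrials π := by
  obtain ⟨d, hd, hmean, hemp⟩ := hM.exists_tendsto π
  have hocc : M.occupancy π = d := funext fun x => (hmean x).limUnder_eq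
  have hall := M.ae_trialsLaw_forall π K hemp
  have hoccK : ∀ᵐ T ∂(M.trialsLaw π K), GUMDP.empOccupancyK T = d := by
    filter_upwards [hall] with T hT
    funext x
    have hKne : (K : ℝ) ≠ 0 := Nat.cast_ne_zero.2 (by omega)
    have hlim : ∀ k, GUMDP.empOccupancy (T k) x = d x := fun k => (hT k x).limUnder_eq
    simp [GUMDP.empOccupancyK, hlim, hKne]
  -- The integrand is almost surely constant, which gives both its integrability and its mean.
  have hutil : (fun T => M.utility (GUMDP.empOccupancyK T)) =ᵐ[M.trialsLaw π K]
      fun _ => M.utility d := hoccK.mono fun T hT => by simp only [hT]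
  refine ⟨fun x => ⟨d x, hmean x⟩, hocc ▸ hd, hall.mono fun T hT k x => ⟨d x, hT k x⟩,
    hoccK.mono fun T hT => hT ▸ hd, (MeasureTheory.integrable_const _).congr hutil.symm, ?_⟩
  rw [GUMDP.finiteTrials, MeasureTheory.integral_congr_ae hutil, GUMDP.infiniteTrials, hocc]
  simp
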